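/- Let $\nabla$ be a smooth linear connection on (the tangent bundle of) $\mathbb{R}^n$, not necessarily torsion free. Its holonomy group at $x\in\mathbb{R}^n$ is the group of all parallel transports along piecewise smooth loops based at $x$, acting on $T_x\mathbb{R}^n$; it is irreducible if it leaves no proper non-trivial linear subspace of $T_x\mathbb{R}^n$ invariant. A semi-Riemannian metric is a smooth field of nondegenerate symmetric bilinear forms on the tangent spaces, and it is parallel if $\nabla g=0$. Metrics are called independent if they are linearly independent at every point (for parallel metrics on $\mathbb{R}^n$ this is equivalent to linear independence over $\mathbb{R}$ as tensor fields). (i) Let $n=2m$ with $m\ge 3$. There exist two independent semi-Riemannian metrics on $\mathbb{R}^n$, both of signature $(m,m)$, and a smooth linear connection on $\mathbb{R}^n$ with respect to which both metrics are parallel and which has irreducible holonomy group. (ii) Let $n=2m$ and $m=2r$ with $r\ge 2$. There exist three independent semi-Riemannian metrics on $\mathbb{R}^n$, all of signature $(m,m)$, and a smooth linear connection on $\mathbb{R}^n$ with respect to which all three metrics are parallel and which has irreducible holonomy group. -/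

import Mathlib

open scoped Manifold ContDiff

noncomputable section

namespace Holonomy

variable {E : Type*} [NormedAddCommGroup E] [NormedSpace ℝ E]

/-- A covariant derivative on the tangent bundle of the manifold `E`
(not assumed to be torsion free). -/
abbrev LinearConnection (E : Type*) [NormedAddCommGroup E] [NormedSpace ℝ E] :=
  CovariantDerivative 𝓘(ℝ, E) E (fun x : E => TangentSpace 𝓘(ℝ, E) x)

/-- The covariant derivative of a vector field `Y`: `cov.nabla Y x u` is `∇_u Y` at the point `x`,
with all tangent spaces of `E` identified with `E`. -/
def LinearConnection.nabla (cov : LinearConnection E) (Y : E → E) (x : E) : E →L[ℝ] E :=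
  cov Y x

/-- A smooth linear connection: the tensor field `∇Y` is smooth for every smooth vector field `Y`
(equivalently, its Christoffel symbols are smooth). -/
def LinearConnection.IsSmooth (cov : LinearConnection E) : Prop :=
  ∀ Y : E → E, ContDiff ℝ ∞ Y → ContDiff ℝ ∞ (cov.nabla Y)

variable (E) in
/-- A semi-Riemannian metric on `E`: a smooth field of nondegenerate symmetric bilinear forms. -/
structure SemiRiemannianMetric where
  form : E → E →L[ℝ] E →L[ℝ] ℝ
  smooth : ContDiff ℝ ∞ form
  symm : ∀ x v w, form x v w = form x w v
  nondegenerate : ∀ x v, (∀ w, form x v w = 0) → v = 0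

/-- The quadratic form `v ↦ g_x(v, v)`. -/
def SemiRiemannianMetric.quadraticForm (g : SemiRiemannianMetric E) (x : E) :
    QuadraticForm ℝ E :=
  LinearMap.BilinMap.toQuadraticMap (g.form x).toBilinForm

/-- The metric `g` has signature `(p, q)` at every point. -/
def SemiRiemannianMetric.HasSignature (g : SemiRiemannianMetric E) (p q : ℕ) : Prop :=
  ∀ x, sigPos (g.quadraticForm x) = p ∧ sigNeg (g.quadraticForm x) = q

/-- Linear independence of the metrics at every point (hence also as tensor fields,
over the real numbers). -/
def SemiRiemannianMetric.Independent {ι : Type*} (g : ι → SemiRiemannianMetric E) : Prop :=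
  ∀ x, LinearIndependent ℝ (fun i => (g i).form x)

/-- `∇ g = 0`, that is, `u (g(Y, Z)) = g(∇_u Y, Z) + g(Y, ∇_u Z)` for all smooth vector
fields `Y`, `Z` and all tangent vectors `u`. -/
def SemiRiemannianMetric.IsParallel (g : SemiRiemannianMetric E)
    (cov : LinearConnection E) : Prop :=
  ∀ Y Z : E → E, ContDiff ℝ ∞ Y → ContDiff ℝ ∞ Z → ∀ x u : E,
    fderiv ℝ (fun y => g.form y (Y y) (Z y)) x u =
      g.form x (cov.nabla Y x u) (Z x) + g.form x (Y x) (cov.nabla Z x u)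

namespace LinearConnection

/-- The vector field `V` along the curve `γ : [0, 1] → E` is parallel. In the global frame of
constant vector fields `∂_j`, its covariant derivative along `γ` is
`V' + ∑ j, V^j ∇_{γ'} ∂_j`, and the sum is the covariant derivative in direction `γ'(t)`, at the
point `γ(t)`, of the constant vector field with value `V(t)`. -/
def IsParallelAlong (cov : LinearConnection E) (γ V : ℝ → E) : Prop :=
  ∀ t ∈ Set.Icc (0 : ℝ) 1,
    HasDerivWithinAt V
      (-(cov.nabla (fun _ => V t) (γ t) (derivWithin γ (Set.Icc 0 1) t))) (Set.Icc 0 1) t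

/-- `cov.IsTransport x y T`: the linear isomorphism `T : T_x E → T_y E` is the parallel transport
along some piecewise smooth curve from `x` to `y`, i.e. along a finite concatenation of smooth
curves `[0, 1] → E`. -/
inductive IsTransport (cov : LinearConnection E) : E → E → (E ≃ₗ[ℝ] E) → Prop
  | smooth (γ : ℝ → E) (T : E ≃ₗ[ℝ] E) (hγ : ContDiffOn ℝ ∞ γ (Set.Icc 0 1))
      (hT : ∀ v, ∃ V : ℝ → E, cov.IsParallelAlong γ V ∧ V 0 = v ∧ V 1 = T v) :
      IsTransport cov (γ 0) (γ 1) T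
  | concat {x y z : E} {S T : E ≃ₗ[ℝ] E} (hS : IsTransport cov x y S)
      (hT : IsTransport cov y z T) : IsTransport cov x z (S.trans T)

theorem IsTransport.refl (cov : LinearConnection E) (x : E) :
    cov.IsTransport x x (LinearEquiv.refl ℝ E) := by
  refine IsTransport.smooth (cov := cov) (fun _ => x) _ contDiffOn_const fun v => ?_
  refine ⟨fun _ => v, fun t _ => ?_, rfl, rfl⟩
  have h := hasDerivWithinAt_const t (Set.Icc (0 : ℝ) 1) v
  have h0 : derivWithin (fun _ : ℝ => x) (Set.Icc 0 1) t = 0 := by simp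
  rw [h0, map_zero, neg_zero]
  exact h

theorem IsTransport.inv {cov : LinearConnection E} {x y : E} {T : E ≃ₗ[ℝ] E}
    (h : cov.IsTransport x y T) : cov.IsTransport y x T.symm := by
  induction h with
  | concat _ _ hS hT => exact hT.concat hS
  | smooth γ T hγ hT =>
    have hmaps : Set.MapsTo (fun t : ℝ => 1 - t) (Set.Icc 0 1) (Set.Icc 0 1) := by
      intro t ht
      simp only [Set.mem_Icc] at ht ⊢
      constructor <;> linarith [ht.1, ht.2]
    have hrev : ∀ (f : ℝ → E) (f' : E) (t : ℝ),
        HasDerivWithinAt f f' (Set.Icc 0 1) (1 - t) →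
        HasDerivWithinAt (fun s => f (1 - s)) (-f') (Set.Icc 0 1) t := by
      intro f f' t hf
      have h1 : HasDerivWithinAt (fun s : ℝ => 1 - s) (-1) (Set.Icc 0 1) t := by
        simpa using (hasDerivWithinAt_id t (Set.Icc (0 : ℝ) 1)).const_sub 1
      simpa [Function.comp_def] using HasDerivWithinAt.scomp t hf h1 hmaps
    have key := IsTransport.smooth (cov := cov) (fun t => γ (1 - t)) T.symm
      (hγ.comp (by fun_prop) hmaps) (fun v => ?_)
    · simpa using key
    · obtain ⟨V, hV, hV0, hV1⟩ := hT (T.symm v)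
      refine ⟨fun t => V (1 - t), fun t ht => ?_, by simpa using hV1, by simpa using hV0⟩
      have hγ' := hrev γ _ t
        ((hγ.differentiableOn (by simp) (1 - t) (hmaps ht)).hasDerivWithinAt)
      have hd := hγ'.derivWithin (uniqueDiffOn_Icc zero_lt_one t ht)
      have := hrev V _ t (hV (1 - t) (hmaps ht))
      beta_reduce
      rw [hd, map_neg]
      exact this

/-- The holonomy group at `x`: all parallel transports along piecewise smooth loops at `x`. -/
def holonomyGroup (cov : LinearConnection E) (x : E) : Subgroup (E ≃ₗ[ℝ] E) where
  carrier := {T | cov.IsTransport x x T}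
  mul_mem' hS hT := IsTransport.concat hT hS
  one_mem' := IsTransport.refl cov x
  inv_mem' hT := hT.inv

/-- The holonomy group at every point leaves no proper nontrivial subspace invariant. -/
def HasIrreducibleHolonomy (cov : LinearConnection E) : Prop :=
  ∀ x, ∀ W : Submodule ℝ E, (∀ T ∈ cov.holonomyGroup x, ∀ w ∈ W, T w ∈ W) → W = ⊥ ∨ W = ⊤

end LinearConnection

end Holonomy

end

/-!
Let `S` be a space of endomorphisms of `E` and let `P` be a polynomial curve in `S` that spans `S`
and starts at `0`. The connection `d + P(x₁) dx₂` has values in `S`, and its holonomy around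
rectangles in the `(x₁, x₂)`-plane consists of the products `exp(s P(a)) exp(-s P(b))`.
Differentiating at `s = 0` shows that every holonomy invariant subspace is invariant under all
differences `P(a) - P(b)`, hence under `S`. Taking for `S` the common infinitesimal isometries of
a family of scalar products makes these parallel, so it suffices to find independent scalar
products for which `S` acts irreducibly.

For an anti-involution `σ` of `K = ℂ` or `ℍ`, consider the Hermitian form `∑ σ(x_a) y_a` on `K ^ ι`.
Its composition with each `σ`-invariant real functional on `K` is a scalar product, and all of these
share the rotations `x ↦ q x_a e_b - σ(q) x_b e_a`, which act irreducibly. So there are as many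
metrics as the dimension of the fixed space of `σ`: two for the identity of `ℂ` and three for the
reversion of `ℍ`, which negates one imaginary unit. The diagonal rotations `a = b` vanish when `σ`
is the identity, which is why `ℂ` requires a third coordinate.
-/

noncomputable section

namespace Holonomy

variable {E : Type*} [NormedAddCommGroup E] [NormedSpace ℝ E]

namespace LinearConnection

theorem differentiableAt_of_mdifferentiableAt_section {Y : E → E} {x : E}
    (hY : MDifferentiableAt 𝓘(ℝ, E) (𝓘(ℝ, E).prod 𝓘(ℝ, E))
      (fun y => (⟨y, Y y⟩ : TangentBundle 𝓘(ℝ, E) E)) x) : DifferentiableAt ℝ Y x :=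
  (((contMDiff_snd_tangentBundle_modelSpace E 𝓘(ℝ, E) (n := 1)).mdifferentiable
    (by simp)).mdifferentiableAt.comp x hY).differentiableAt

variable (E) in
/-- The trivial connection `d`, for which the constant vector fields are parallel. -/
def trivial : LinearConnection E where
  toFun Y x := fderiv ℝ (F := E) Y x
  isCovariantDerivativeOnUniv :=
    { add hY hZ _ := by
        have hYZ := fderiv_add (differentiableAt_of_mdifferentiableAt_section hY)
          (differentiableAt_of_mdifferentiableAt_section hZ)
        exact hYZ
      leibniz {_ f x} hY hf _ := by
        have hdf : mvfderiv 𝓘(ℝ, E) f x = fderiv ℝ f x := by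
          simp only [mvfderiv, mfderiv_eq_fderiv]
          rfl
        have hfY := fderiv_smul hf.differentiableAt
          (differentiableAt_of_mdifferentiableAt_section hY)
        rw [hdf]
        exact hfY }

/-- The connection `d + A`. The argument order is `∇_u Y = dY(u) + A(Y, u)`: the differentiated
field comes first. -/
def ofForm (A : E → E →L[ℝ] E →L[ℝ] E) : LinearConnection E :=
  (trivial E).addOneForm A

theorem nabla_ofForm (A : E → E →L[ℝ] E →L[ℝ] E) (Y : E → E) (x : E) :
    (ofForm A).nabla Y x = fderiv ℝ Y x + A x (Y x) :=
  rfl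

theorem isSmooth_ofForm {A : E → E →L[ℝ] E →L[ℝ] E} (hA : ContDiff ℝ ∞ A) :
    (ofForm A).IsSmooth :=
  fun _ hY => (hY.fderiv_right (by simp)).add (hA.clm_apply hY)

end LinearConnection

section Exponential

variable [CompleteSpace E]

/-- The exponential of an endomorphism, as a linear automorphism. -/
def expEquiv (P : E →L[ℝ] E) : E ≃ₗ[ℝ] E :=
  let _ : NormedAlgebra ℚ (E →L[ℝ] E) := NormedAlgebra.restrictScalars ℚ ℝ _
  (ContinuousLinearEquiv.unitsEquiv ℝ E (NormedSpace.isUnit_exp P).unit).toLinearEquiv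

theorem expEquiv_apply (P : E →L[ℝ] E) (v : E) : expEquiv P v = NormedSpace.exp P v :=
  rfl

theorem hasDerivAt_expEquiv_smul_apply (P : E →L[ℝ] E) (v : E) (t : ℝ) :
    HasDerivAt (fun s : ℝ => expEquiv (s • P) v) (P (expEquiv (t • P) v)) t :=
  (ContinuousLinearMap.apply ℝ E v).hasFDerivAt.comp_hasDerivAt t
    (hasDerivAt_exp_smul_const' (𝕂 := ℝ) P t)

theorem hasDerivAt_expEquiv_smul_expEquiv_smul (P Q : E →L[ℝ] E) (v : E) :
    HasDerivAt (fun s : ℝ => expEquiv (s • P) (expEquiv (s • Q) v)) (P v + Q v) 0 := by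
  have h := (hasDerivAt_exp_smul_const (𝕂 := ℝ) P 0).clm_apply
    (hasDerivAt_expEquiv_smul_apply Q v 0)
  simpa [expEquiv_apply] using h

/-- If the endomorphism `A(·, u)` is constant along a segment of direction `u`, then the parallel
transport equation has constant coefficients there. -/
theorem isTransport_segment {A : E → E →L[ℝ] E →L[ℝ] E} {x u : E} {P : E →L[ℝ] E}
    (hP : ∀ t ∈ Set.Icc (0 : ℝ) 1, (A (x + t • u)).flip u = P) :
    (LinearConnection.ofForm A).IsTransport x (x + u) (expEquiv (-P)) := by
  have hγ (t : ℝ) : HasDerivAt (fun t : ℝ => x + t • u) u t := by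
    simpa using ((hasDerivAt_id t).smul_const u).const_add x
  have h := LinearConnection.IsTransport.smooth (cov := .ofForm A) (fun t : ℝ => x + t • u)
    (expEquiv (-P)) (by fun_prop) fun v => ⟨fun t => expEquiv (t • -P) v, fun t ht => ?_,
      by simp [expEquiv_apply], by simp⟩
  · simpa using h
  · have hPt (w : E) : A (x + t • u) w u = P w := by rw [← hP t ht]; rfl
    rw [(hγ t).hasDerivWithinAt.derivWithin (uniqueDiffOn_Icc zero_lt_one t ht),
      LinearConnection.nabla_ofForm]
    simpa [hPt] using (hasDerivAt_expEquiv_smul_apply (-P) v t).hasDerivWithinAt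

end Exponential

section Shear

/-- The connection form `A(v, u) = ℓ₂(u) P(ℓ₁(x)) v`. -/
def shearForm (ℓ₁ ℓ₂ : E →L[ℝ] ℝ) (P : ℝ → E →L[ℝ] E) (x : E) : E →L[ℝ] E →L[ℝ] E :=
  (ContinuousLinearMap.smulRightL ℝ E E ℓ₂).comp (P (ℓ₁ x))

theorem flip_shearForm (ℓ₁ ℓ₂ : E →L[ℝ] ℝ) (P : ℝ → E →L[ℝ] E) (x u : E) :
    (shearForm ℓ₁ ℓ₂ P x).flip u = ℓ₂ u • P (ℓ₁ x) :=
  rfl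

theorem contDiff_shearForm (ℓ₁ ℓ₂ : E →L[ℝ] ℝ) {P : ℝ → E →L[ℝ] E} (hP : ContDiff ℝ ∞ P) :
    ContDiff ℝ ∞ (shearForm ℓ₁ ℓ₂ P) :=
  contDiff_const.clm_comp (hP.comp ℓ₁.contDiff)

variable {ℓ₁ ℓ₂ : E →L[ℝ] ℝ} {P : ℝ → E →L[ℝ] E} {e₁ e₂ : E}

theorem isTransport_shearForm [CompleteSpace E] (x : E) {u : E} (hu : ℓ₁ u = 0 ∨ ℓ₂ u = 0) :
    (LinearConnection.ofForm (shearForm ℓ₁ ℓ₂ P)).IsTransport x (x + u)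
      (expEquiv (-ℓ₂ u • P (ℓ₁ x))) := by
  rw [neg_smul]
  refine isTransport_segment fun t _ => ?_
  rw [flip_shearForm]
  obtain h | h := hu <;> simp [h]

/-- The holonomy around the rectangle with sides `(b - ℓ₁(x)) e₁` and `s e₂`: only the sides
parallel to `e₂` contribute. -/
theorem exp_trans_exp_mem_holonomyGroup [CompleteSpace E] (h₁₁ : ℓ₁ e₁ = 1) (h₂₁ : ℓ₂ e₁ = 0)
    (h₁₂ : ℓ₁ e₂ = 0) (h₂₂ : ℓ₂ e₂ = 1) (x : E) (b s : ℝ) :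
    (expEquiv (s • -P b)).trans (expEquiv (s • P (ℓ₁ x))) ∈
      (LinearConnection.ofForm (shearForm ℓ₁ ℓ₂ P)).holonomyGroup x := by
  set a := b - ℓ₁ x with ha
  have side (y u : E) (hu : ℓ₁ u = 0 ∨ ℓ₂ u = 0) := isTransport_shearForm (P := P) y hu
  have h := (((side x (a • e₁) (by simp [h₂₁])).concat
    (side _ (s • e₂) (by simp [h₁₂]))).concat
    (side _ (-a • e₁) (by simp [h₂₁]))).concat (side _ (-s • e₂) (by simp [h₁₂]))
  have hx : x + a • e₁ + s • e₂ + (-a) • e₁ + (-s) • e₂ = x := by module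
  rw [hx] at h
  have hid : expEquiv (0 : E →L[ℝ] E) = .refl ℝ E := by
    ext v
    simp [expEquiv_apply]
  change LinearConnection.IsTransport _ x x _
  simpa [h₁₁, h₂₁, h₁₂, h₂₂, ha, hid] using h

theorem mem_of_hasDerivAt_of_forall_mem {W : Submodule ℝ E} (hW : IsClosed (W : Set E))
    {f : ℝ → E} {f' : E} {t : ℝ} (hf : HasDerivAt f f' t) (h : ∀ s, f s ∈ W) : f' ∈ W := by
  have hspan : Submodule.span ℝ (f '' Set.univ) ≤ W :=
    Submodule.span_le.2 (by simpa [Set.range_subset_iff] using h)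
  rw [← hf.deriv]
  exact closure_minimal hspan hW
    (range_deriv_subset_closure_span_image f dense_univ (Set.mem_range_self t))

theorem sub_apply_mem_of_holonomy_invariant [FiniteDimensional ℝ E] (h₁₁ : ℓ₁ e₁ = 1)
    (h₂₁ : ℓ₂ e₁ = 0) (h₁₂ : ℓ₁ e₂ = 0) (h₂₂ : ℓ₂ e₂ = 1) {x : E} {W : Submodule ℝ E}
    (hW : ∀ T ∈ (LinearConnection.ofForm (shearForm ℓ₁ ℓ₂ P)).holonomyGroup x, ∀ w ∈ W, T w ∈ W)
    {w : E} (hw : w ∈ W) (b : ℝ) : P (ℓ₁ x) w - P b w ∈ W := by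
  have : CompleteSpace E := FiniteDimensional.complete ℝ E
  rw [sub_eq_add_neg]
  exact mem_of_hasDerivAt_of_forall_mem W.closed_of_finiteDimensional
    (hasDerivAt_expEquiv_smul_expEquiv_smul (P (ℓ₁ x)) (-P b) w)
    fun s => hW _ (exp_trans_exp_mem_holonomyGroup h₁₁ h₂₁ h₁₂ h₂₂ x b s) w hw

end Shear

section MomentCurve

variable {k V : Type*} [Field k] [AddCommGroup V] [Module k V] {N : ℕ}

/-- The curve `t ↦ ∑ j, t ^ (j + 1) M_j`, which passes through `0` at `t = 0` and spans the span of
the `M_j`. -/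
def momentCurve (M : Fin N → V) (t : k) : V :=
  ∑ j, t ^ (j.val + 1) • M j

theorem map_momentCurve {V' : Type*} [AddCommGroup V'] [Module k V'] (f : V →ₗ[k] V')
    (M : Fin N → V) (t : k) : f (momentCurve M t) = momentCurve (fun j => f (M j)) t := by
  simp only [momentCurve, map_sum, map_smul]

theorem momentCurve_zero (M : Fin N → V) : momentCurve M (0 : k) = 0 := by
  simp [momentCurve]

theorem momentCurve_mem {W : Submodule k V} {M : Fin N → V} (hM : ∀ j, M j ∈ W) (t : k) :
    momentCurve M t ∈ W :=
  W.sum_mem fun j _ => W.smul_mem _ (hM j)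

open Polynomial in
theorem eq_zero_of_momentCurve_eq_zero [Infinite k] {c : Fin N → k}
    (h : ∀ t : k, momentCurve c t = 0) (j : Fin N) : c j = 0 := by
  have hp : ∑ i, C (c i) * X ^ (i.val + 1) = 0 := by
    refine Polynomial.funext fun t => ?_
    simpa [momentCurve, eval_finsetSum, mul_comm (c _)] using h t
  simpa [finsetSum_coeff, coeff_C_mul, coeff_X_pow, Fin.val_inj] using
    congrArg (fun p => p.coeff (j.val + 1)) hp

theorem mem_of_momentCurve_mem [Infinite k] {W : Submodule k V} {M : Fin N → V}
    (h : ∀ t : k, momentCurve M t ∈ W) (j : Fin N) : M j ∈ W := by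
  rw [← Subspace.forall_mem_dualAnnihilator_apply_eq_zero_iff]
  intro φ hφ
  refine eq_zero_of_momentCurve_eq_zero (c := fun j => φ (M j)) (fun t => ?_) j
  rw [← map_momentCurve]
  exact (Submodule.mem_dualAnnihilator φ).1 hφ _ (h t)

end MomentCurve

theorem exists_dual_pair [FiniteDimensional ℝ E] (hE : 1 < Module.finrank ℝ E) :
    ∃ (ℓ₁ ℓ₂ : E →L[ℝ] ℝ) (e₁ e₂ : E), ℓ₁ e₁ = 1 ∧ ℓ₂ e₁ = 0 ∧ ℓ₁ e₂ = 0 ∧ ℓ₂ e₂ = 1 := by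
  have b := Module.finBasis ℝ E
  have : Nontrivial (Fin (Module.finrank ℝ E)) := Fin.nontrivial_iff_two_le.2 hE
  obtain ⟨i, j, hij⟩ := exists_pair_ne (Fin (Module.finrank ℝ E))
  exact ⟨(b.coord i).toContinuousLinearMap, (b.coord j).toContinuousLinearMap, b i, b j,
    by simp, by simp [hij], by simp [hij.symm], by simp⟩

theorem exists_connectionForm_mem_invtSubmodule [FiniteDimensional ℝ E]
    (hE : 1 < Module.finrank ℝ E) (S : Submodule ℝ (Module.End ℝ E)) :
    ∃ A : E → E →L[ℝ] E →L[ℝ] E, ContDiff ℝ ∞ A ∧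
      (∀ x u, ((A x).flip u).toLinearMap ∈ S) ∧
      ∀ x (W : Submodule ℝ E),
        (∀ T ∈ (LinearConnection.ofForm A).holonomyGroup x, ∀ w ∈ W, T w ∈ W) →
        ∀ f ∈ S, W ∈ f.invtSubmodule := by
  obtain ⟨ℓ₁, ℓ₂, e₁, e₂, h₁₁, h₂₁, h₁₂, h₂₂⟩ := exists_dual_pair hE
  obtain ⟨N, M, rfl⟩ :=
    Submodule.fg_iff_exists_fin_generating_family.1 (IsNoetherian.noetherian S)
  let P (t : ℝ) : E →L[ℝ] E := LinearMap.toContinuousLinearMap (momentCurve M t)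
  have hP_smooth : ContDiff ℝ ∞ P := by
    simp only [P, momentCurve, map_sum, map_smul]
    fun_prop
  refine ⟨shearForm ℓ₁ ℓ₂ P, contDiff_shearForm _ _ hP_smooth, fun x u => ?_, fun x W hW => ?_⟩
  · rw [flip_shearForm, ContinuousLinearMap.toLinearMap_smul]
    exact Submodule.smul_mem _ _
      (momentCurve_mem (fun j => Submodule.subset_span (Set.mem_range_self j)) _)
  · have hsub {w : E} (hw : w ∈ W) (b : ℝ) :=
      sub_apply_mem_of_holonomy_invariant h₁₁ h₂₁ h₁₂ h₂₂ hW hw b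
    have hbase {w : E} (hw : w ∈ W) : P (ℓ₁ x) w ∈ W := by
      simpa [P, momentCurve_zero] using hsub hw 0
    have hcurve {w : E} (hw : w ∈ W) (b : ℝ) : momentCurve (fun j => M j w) b ∈ W := by
      have happly : momentCurve M b w = momentCurve (fun j => M j w) b :=
        map_momentCurve (LinearMap.applyₗ w) M b
      rw [← happly]
      exact (W.sub_mem_iff_right (hbase hw)).1 (hsub hw b)
    have hspan : Submodule.span ℝ (Set.range M) ≤ W.compatibleMaps W :=
      Submodule.span_le.2 <| Set.range_subset_iff.2 fun j w hw =>
        mem_of_momentCurve_mem (hcurve hw) j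
    exact fun f hf => hspan hf

section Family

variable {k V V' ι : Type*} [CommRing k] [AddCommGroup V] [Module k V] [AddCommGroup V']
  [Module k V']

/-- The algebraic input of the construction: independent scalar products, each isometric to its
negative, whose common infinitesimal isometries act irreducibly. -/
structure IsIrreducibleNeutralFamily (B : ι → LinearMap.BilinForm k V) : Prop where
  isSymm : ∀ i, (B i).IsSymm
  nondegenerate : ∀ i, (B i).Nondegenerate
  linearIndependent : LinearIndependent k B
  equivalent_neg : ∀ i, (LinearMap.BilinMap.toQuadraticMap (B i)).Equivalent
    (-LinearMap.BilinMap.toQuadraticMap (B i))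
  irreducible : ∀ W : Submodule k V,
    (∀ f ∈ ⨅ i, (B i).skewAdjointSubmodule, W ∈ Module.End.invtSubmodule f) → W = ⊥ ∨ W = ⊤

theorem conj_mem_skewAdjointSubmodule_congr {b : LinearMap.BilinForm k V} (e : V ≃ₗ[k] V')
    {f : Module.End k V} (hf : f ∈ b.skewAdjointSubmodule) :
    e.conj f ∈ (LinearMap.BilinForm.congr e b).skewAdjointSubmodule := by
  rw [LinearMap.mem_skewAdjointSubmodule] at hf ⊢
  intro v w
  simpa [LinearMap.BilinForm.congr_apply] using hf (e.symm v) (e.symm w)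

theorem IsIrreducibleNeutralFamily.congr {B : ι → LinearMap.BilinForm k V}
    (hB : IsIrreducibleNeutralFamily B) (e : V ≃ₗ[k] V') :
    IsIrreducibleNeutralFamily fun i => LinearMap.BilinForm.congr e (B i) where
  isSymm i := ⟨fun v w => by
    simpa only [LinearMap.BilinForm.congr_apply] using (hB.isSymm i).eq (e.symm v) (e.symm w)⟩
  nondegenerate i := (hB.nondegenerate i).congr e
  linearIndependent :=
    hB.linearIndependent.map_injOn (LinearMap.BilinForm.congr e).toLinearMap
      (LinearMap.BilinForm.congr e).injective.injOn
  equivalent_neg i := by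
    obtain ⟨φ⟩ := hB.equivalent_neg i
    exact ⟨{ e.symm ≪≫ₗ φ.toLinearEquiv ≪≫ₗ e with
      map_app' := fun v => by
        simpa [LinearMap.BilinForm.congr_apply] using φ.map_app (e.symm v) }⟩
  irreducible W hW := by
    have hcomap (f) (hf : f ∈ ⨅ i, (B i).skewAdjointSubmodule) :
        W.comap e.toLinearMap ∈ f.invtSubmodule := by
      intro v hv
      rw [Submodule.mem_iInf] at hf
      have hconj := hW (e.conj f) ((Submodule.mem_iInf _).2 fun i =>
        conj_mem_skewAdjointSubmodule_congr e (hf i)) hv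
      simpa using hconj
    have hinj := Submodule.comap_injective_of_surjective (f := e.toLinearMap) e.surjective
    refine (hB.irreducible _ hcomap).imp (fun h => hinj ?_) fun h => hinj ?_
    · rw [h]; exact e.ker.symm
    · rw [h, Submodule.comap_top]

end Family

section Hermitian

/-- An involutive `k`-linear anti-automorphism. -/
structure IsAntiInvolution {k K : Type*} [CommRing k] [Ring K] [Algebra k K] (σ : K →ₗ[k] K) :
    Prop where
  map_mul : ∀ p q, σ (p * q) = σ q * σ p
  involutive : Function.Involutive σ

theorem isAntiInvolution_id {k K : Type*} [CommRing k] [CommRing K] [Algebra k K] :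
    IsAntiInvolution (LinearMap.id : K →ₗ[k] K) where
  map_mul := mul_comm
  involutive _ := rfl

section Form

variable {k K ι : Type*} [CommRing k] [Ring K] [Algebra k K] {σ : K →ₗ[k] K} [Fintype ι]

theorem IsAntiInvolution.map_one (hσ : IsAntiInvolution σ) : σ 1 = 1 := by
  simpa [hσ.involutive 1] using (hσ.map_mul (σ 1) 1).symm

variable (ι σ) in
/-- The `K`-valued `σ`-Hermitian form `∑ a, σ (x a) * y a` on `K ^ ι`, as a `k`-bilinear map. -/
def hermitianForm : (ι → K) →ₗ[k] (ι → K) →ₗ[k] K :=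
  ∑ a, (LinearMap.mul k K).compl₁₂ (σ ∘ₗ LinearMap.proj a) (LinearMap.proj a)

theorem hermitianForm_apply (x y : ι → K) : hermitianForm ι σ x y = ∑ a, σ (x a) * y a := by
  simp [hermitianForm]

theorem map_hermitianForm (hσ : IsAntiInvolution σ) (x y : ι → K) :
    σ (hermitianForm ι σ x y) = hermitianForm ι σ y x := by
  simp [hermitianForm_apply, hσ.map_mul, hσ.involutive _]

theorem isSymm_hermitianForm_compr₂ (hσ : IsAntiInvolution σ) {l : K →ₗ[k] k} (hl : l ∘ₗ σ = l) :
    LinearMap.BilinForm.IsSymm ((hermitianForm ι σ).compr₂ l) where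
  eq x y := by
    rw [LinearMap.compr₂_apply, LinearMap.compr₂_apply, ← map_hermitianForm hσ x y]
    exact (LinearMap.congr_fun hl _).symm

theorem hermitianForm_mul_right (hσ : IsAntiInvolution σ) (x y : ι → K) (s : K) :
    hermitianForm ι σ (fun a => x a * s) (fun a => y a * s) =
      σ s * hermitianForm ι σ x y * s := by
  simp only [hermitianForm_apply, hσ.map_mul, Finset.mul_sum, Finset.sum_mul, mul_assoc]

theorem equivalent_neg_hermitianForm_compr₂ (hσ : IsAntiInvolution σ) {l : K →ₗ[k] k}
    (s : Kˣ) (hs : ∀ q, l (σ s * q * s) = -l q) :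
    (LinearMap.BilinMap.toQuadraticMap ((hermitianForm ι σ).compr₂ l)).Equivalent
      (-LinearMap.BilinMap.toQuadraticMap ((hermitianForm ι σ).compr₂ l)) :=
  ⟨{ LinearEquiv.piCongrRight fun _ : ι => Units.mulRightLinearEquiv k s with
      map_app' := fun x => by
        have h := congrArg l (hermitianForm_mul_right hσ x x s)
        rw [hs] at h
        exact neg_eq_iff_eq_neg.2 h }⟩

theorem hermitianForm_single_right [DecidableEq ι] (x : ι → K) (a : ι) (z : K) :
    hermitianForm ι σ x (Pi.single a z) = σ (x a) * z := by
  simp [hermitianForm_apply, Pi.single_apply]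

theorem hermitianForm_single_left [DecidableEq ι] (a : ι) (z : K) (y : ι → K) :
    hermitianForm ι σ (Pi.single a z) y = σ z * y a := by
  simp [hermitianForm_apply, Pi.single_apply, apply_ite]

theorem linearIndependent_hermitianForm_compr₂ [Nonempty ι] (hσ : IsAntiInvolution σ)
    {κ : Type*} {l : κ → K →ₗ[k] k} (hl : LinearIndependent k l) :
    LinearIndependent k fun i => (hermitianForm ι σ).compr₂ (l i) := by
  classical
  obtain ⟨a⟩ := ‹Nonempty ι›
  refine LinearIndependent.of_comp (LinearMap.lcomp k k (LinearMap.single k (fun _ => K) a) ∘ₗ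
    LinearMap.applyₗ (Pi.single a 1)) ?_
  convert hl with i
  ext z
  simp [hermitianForm_single_left, hσ.map_one]

theorem nondegenerate_hermitianForm_compr₂ {K : Type*} [DivisionRing K] [Algebra k K]
    {σ : K →ₗ[k] K} (hσ : IsAntiInvolution σ) {l : K →ₗ[k] k} (hl : l ≠ 0) (hlσ : l ∘ₗ σ = l) :
    LinearMap.BilinForm.Nondegenerate ((hermitianForm ι σ).compr₂ l) := by
  classical
  rw [LinearMap.BilinForm.Nondegenerate,
    (isSymm_hermitianForm_compr₂ hσ hlσ).isRefl.nondegenerate_iff_separatingLeft]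
  intro x hx
  by_contra hx0
  obtain ⟨a, ha⟩ := Function.ne_iff.1 hx0
  have hσa : σ (x a) ≠ 0 := (map_ne_zero_iff σ hσ.involutive.injective).2 ha
  refine hl (LinearMap.ext fun z => ?_)
  simpa [hermitianForm_single_right, mul_inv_cancel_left₀ hσa] using
    hx (Pi.single a ((σ (x a))⁻¹ * z))

end Form

section Rotation

variable {k K ι : Type*} [CommRing k] [DecidableEq ι]

section Ring

variable [Ring K] [Algebra k K]

/-- The infinitesimal isometry `x ↦ q x_a e_b - σ(q) x_b e_a` of the Hermitian form. -/
def hermitianRotation (σ : K →ₗ[k] K) (a b : ι) (q : K) : Module.End k (ι → K) :=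
  LinearMap.single k _ b ∘ₗ LinearMap.mulLeft k q ∘ₗ LinearMap.proj a -
    LinearMap.single k _ a ∘ₗ LinearMap.mulLeft k (σ q) ∘ₗ LinearMap.proj b

variable {σ : K →ₗ[k] K}

theorem hermitianRotation_apply (a b : ι) (q : K) (x : ι → K) :
    hermitianRotation σ a b q x = Pi.single b (q * x a) - Pi.single a (σ q * x b) :=
  rfl

theorem isSkewAdjoint_hermitianRotation [Fintype ι] (hσ : IsAntiInvolution σ) (l : K →ₗ[k] k)
    (a b : ι) (q : K) :
    LinearMap.IsSkewAdjoint ((hermitianForm ι σ).compr₂ l) (hermitianRotation σ a b q) := by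
  intro x y
  simp [hermitianRotation_apply, hermitianForm_single_left, hermitianForm_single_right,
    hσ.map_mul, hσ.involutive _, mul_assoc]

end Ring

variable [DivisionRing K] [Algebra k K] {σ : K →ₗ[k] K} {W : Submodule k (ι → K)}

theorem single_mem_of_invariant {a b : ι} {p : K}
    (hW : ∀ q, W ∈ (hermitianRotation σ a b q).invtSubmodule) (hab : a ≠ b) (hp : p ≠ 0)
    (h : Pi.single a p ∈ W) (z : K) : Pi.single b z ∈ W := by
  simpa [hermitianRotation_apply, hab, hp] using hW (z * p⁻¹) h

theorem eq_top_of_single_mem_of_invariant [Finite ι] [Nontrivial ι]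
    (hW : ∀ a b q, W ∈ (hermitianRotation σ a b q).invtSubmodule)
    {a : ι} {p : K} (hp : p ≠ 0) (h : Pi.single a p ∈ W) : W = ⊤ := by
  have hother {b : ι} (hab : a ≠ b) (z : K) : Pi.single b z ∈ W :=
    single_mem_of_invariant (hW a b) hab hp h z
  have hsame (z : K) : Pi.single a z ∈ W := by
    obtain ⟨b, hba⟩ := exists_ne a
    exact single_mem_of_invariant (hW b a) hba one_ne_zero (hother hba.symm 1) z
  cases nonempty_fintype ι
  refine eq_top_iff.2 fun x _ => ?_
  rw [← Finset.univ_sum_single x]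
  refine W.sum_mem fun b _ => ?_
  obtain rfl | hab := eq_or_ne a b
  · exact hsame _
  · exact hother hab _

theorem exists_single_mem_of_invariant (hσ : IsAntiInvolution σ)
    (hι : 3 ≤ ENat.card ι ∨ σ ≠ .id)
    (hW : ∀ a b q, W ∈ (hermitianRotation σ a b q).invtSubmodule) (hW0 : W ≠ ⊥) :
    ∃ (a : ι) (p : K), p ≠ 0 ∧ Pi.single a p ∈ W := by
  obtain ⟨w, hw, hw0⟩ := W.ne_bot_iff.1 hW0
  obtain ⟨a, ha⟩ := Function.ne_iff.1 hw0
  obtain hι | hσ_ne := hι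
  · obtain ⟨b, hba, -⟩ := ENat.exists_ne_ne_of_three_le hι a a
    obtain ⟨d, hda, hdb⟩ := ENat.exists_ne_ne_of_three_le hι a b
    have h := hW b d 1 (hW a b 1 hw)
    refine ⟨d, w a, ha, ?_⟩
    simpa [hermitianRotation_apply, hba, hda, hdb, hσ.map_one] using h
  · obtain ⟨q, hq⟩ := DFunLike.ne_iff.1 hσ_ne
    refine ⟨a, (q - σ q) * w a, mul_ne_zero (sub_ne_zero.2 (Ne.symm hq)) ha, ?_⟩
    simpa [hermitianRotation_apply, sub_mul, Pi.single_sub] using hW a a q hw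

end Rotation

theorem isIrreducibleNeutralFamily_hermitianForm {k K ι κ : Type*} [Field k] [DivisionRing K]
    [Algebra k K] [Fintype ι] [Nontrivial ι] {σ : K →ₗ[k] K} (hσ : IsAntiInvolution σ)
    (hι : 3 ≤ ENat.card ι ∨ σ ≠ .id) {l : κ → K →ₗ[k] k} (hl : LinearIndependent k l)
    (hlσ : ∀ i, l i ∘ₗ σ = l i) (hs : ∀ i, ∃ s : Kˣ, ∀ q, l i (σ s * q * s) = -l i q) :
    IsIrreducibleNeutralFamily fun i => (hermitianForm ι σ).compr₂ (l i) where
  isSymm i := isSymm_hermitianForm_compr₂ hσ (hlσ i)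
  nondegenerate i := nondegenerate_hermitianForm_compr₂ hσ (hl.ne_zero i) (hlσ i)
  linearIndependent := linearIndependent_hermitianForm_compr₂ hσ hl
  equivalent_neg i := by
    obtain ⟨s, hs⟩ := hs i
    exact equivalent_neg_hermitianForm_compr₂ hσ s hs
  irreducible W hW := by
    classical
    have hrot (a b : ι) (q : K) : W ∈ (hermitianRotation σ a b q).invtSubmodule := by
      refine hW _ ?_
      simp only [Submodule.mem_iInf, LinearMap.mem_skewAdjointSubmodule]
      exact fun i => isSkewAdjoint_hermitianRotation hσ (l i) a b q
    refine or_iff_not_imp_left.2 fun hbot => ?_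
    obtain ⟨a, p, hp, h⟩ := exists_single_mem_of_invariant hσ hι hrot hbot
    exact eq_top_of_single_mem_of_invariant hrot hp h

end Hermitian

section Complex

/-- Real and imaginary part, as functionals on `ℂ`. -/
def complexFunctionals : Fin 2 → ℂ →ₗ[ℝ] ℝ :=
  ![Complex.reLm, Complex.imLm]

theorem linearIndependent_complexFunctionals : LinearIndependent ℝ complexFunctionals := by
  refine LinearIndependent.pair_iff.2 fun c d h => ?_
  exact ⟨by simpa using LinearMap.congr_fun h 1, by simpa using LinearMap.congr_fun h Complex.I⟩

theorem isIrreducibleNeutralFamily_complex {ι : Type*} [Fintype ι] (hι : 3 ≤ ENat.card ι) :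
    IsIrreducibleNeutralFamily fun i =>
      (hermitianForm ι (LinearMap.id : ℂ →ₗ[ℝ] ℂ)).compr₂ (complexFunctionals i) := by
  have : Nontrivial ι := (ENat.one_lt_card_iff_nontrivial ι).1
    (lt_of_lt_of_le (by norm_num) hι)
  refine isIrreducibleNeutralFamily_hermitianForm isAntiInvolution_id (.inl hι)
    linearIndependent_complexFunctionals (fun _ => rfl)
    fun i => ⟨Units.mk0 Complex.I Complex.I_ne_zero, fun q => ?_⟩
  have hI : Complex.I * q * Complex.I = -q := by
    rw [mul_right_comm, Complex.I_mul_I, neg_one_mul]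
  simp [hI]

end Complex

section Quaternion

open Quaternion

/-- The reversion of `ℍ`, viewed as the Clifford algebra generated by `i` and `j`: it fixes `i` and
`j` and reverses products, so it negates `k = ij`. -/
def reversion : ℍ →ₗ[ℝ] ℍ where
  toFun q := ⟨q.re, q.imI, q.imJ, -q.imK⟩
  map_add' _ _ := Quaternion.ext _ _ rfl rfl rfl (neg_add _ _)
  map_smul' _ _ := Quaternion.ext _ _ rfl rfl rfl (mul_neg _ _).symm

theorem re_reversion (q : ℍ) : (reversion q).re = q.re := rfl

theorem imI_reversion (q : ℍ) : (reversion q).imI = q.imI := rfl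

theorem imJ_reversion (q : ℍ) : (reversion q).imJ = q.imJ := rfl

theorem imK_reversion (q : ℍ) : (reversion q).imK = -q.imK := rfl

theorem isAntiInvolution_reversion : IsAntiInvolution reversion where
  map_mul p q := by
    ext <;> simp only [re_reversion, imI_reversion, imJ_reversion, imK_reversion,
      Quaternion.re_mul, Quaternion.imI_mul, Quaternion.imJ_mul, Quaternion.imK_mul] <;> ring
  involutive q := by
    ext <;> simp [re_reversion, imI_reversion, imJ_reversion, imK_reversion]

theorem exists_quaternion_components (a b c d : ℝ) :
    ∃ q : ℍ, q.re = a ∧ q.imI = b ∧ q.imJ = c ∧ q.imK = d :=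
  ⟨⟨a, b, c, d⟩, rfl, rfl, rfl, rfl⟩

theorem reversion_ne_id : reversion ≠ .id := by
  intro h
  obtain ⟨q, -, -, -, hq⟩ := exists_quaternion_components 0 0 0 1
  have hk := congrArg QuaternionAlgebra.imK (LinearMap.congr_fun h q)
  rw [imK_reversion, LinearMap.id_apply, hq] at hk
  norm_num at hk

/-- The functionals `re`, `imI` and `imJ`, which are the ones invariant under reversion. -/
def reversionFunctionals : Fin 3 → ℍ →ₗ[ℝ] ℝ :=
  ![QuaternionAlgebra.reₗ _ _ _, QuaternionAlgebra.imIₗ _ _ _, QuaternionAlgebra.imJₗ _ _ _]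

theorem reversionFunctionals_comp_reversion (i : Fin 3) :
    reversionFunctionals i ∘ₗ reversion = reversionFunctionals i := by
  fin_cases i <;> rfl

theorem linearIndependent_reversionFunctionals : LinearIndependent ℝ reversionFunctionals := by
  rw [Fintype.linearIndependent_iff]
  intro c hc
  have heval (q : ℍ) : c 0 * q.re + c 1 * q.imI + c 2 * q.imJ = 0 := by
    have h := LinearMap.congr_fun hc q
    rw [Fin.sum_univ_three] at h
    exact h
  obtain ⟨p, hp⟩ := exists_quaternion_components 1 0 0 0
  obtain ⟨q, hq⟩ := exists_quaternion_components 0 1 0 0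
  obtain ⟨r, hr⟩ := exists_quaternion_components 0 0 1 0
  intro i
  fin_cases i
  · simpa [hp] using heval p
  · simpa [hq] using heval q
  · simpa [hr] using heval r

theorem exists_unit_reversionFunctionals_eq_neg (i : Fin 3) :
    ∃ s : ℍˣ, ∀ q, reversionFunctionals i (reversion s * q * s) = -reversionFunctionals i q := by
  obtain ⟨s, hs⟩ := exists_quaternion_components 0 1 0 0
  obtain ⟨t, ht⟩ := exists_quaternion_components 0 0 1 0
  have hs0 : s ≠ 0 := by rintro rfl; simp at hs
  have ht0 : t ≠ 0 := by rintro rfl; simp at ht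
  fin_cases i
  · refine ⟨Units.mk0 s hs0, fun q => ?_⟩
    change (reversion s * q * s).re = -q.re
    simp [re_reversion, imI_reversion, imJ_reversion, imK_reversion, hs]
  · refine ⟨Units.mk0 s hs0, fun q => ?_⟩
    change (reversion s * q * s).imI = -q.imI
    simp [re_reversion, imI_reversion, imJ_reversion, imK_reversion, hs]
  · refine ⟨Units.mk0 t ht0, fun q => ?_⟩
    change (reversion t * q * t).imJ = -q.imJ
    simp [re_reversion, imI_reversion, imJ_reversion, imK_reversion, ht]

theorem isIrreducibleNeutralFamily_quaternion {ι : Type*} [Fintype ι] [Nontrivial ι] :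
    IsIrreducibleNeutralFamily fun i =>
      (hermitianForm ι reversion).compr₂ (reversionFunctionals i) :=
  isIrreducibleNeutralFamily_hermitianForm isAntiInvolution_reversion (.inr reversion_ne_id)
    linearIndependent_reversionFunctionals reversionFunctionals_comp_reversion
    exists_unit_reversionFunctionals_eq_neg

end Quaternion

section Signature

theorem radical_toQuadraticMap_eq_bot {k V : Type*} [CommRing k] [Invertible (2 : k)]
    [AddCommGroup V] [Module k V] {b : LinearMap.BilinForm k V} (hb_symm : b.IsSymm)
    (hb : b.Nondegenerate) : (LinearMap.BilinMap.toQuadraticMap b).radical = ⊥ := by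
  rw [QuadraticMap.radical_eq_ker_associated, QuadraticMap.associated_left_inverse k hb_symm.eq]
  exact hb.ker_eq_bot

theorem sigPos_eq_and_sigNeg_eq_of_equivalent_neg {V : Type*} [AddCommGroup V] [Module ℝ V]
    [FiniteDimensional ℝ V] {Q : QuadraticForm ℝ V} (hQ : Q.radical = ⊥)
    (hneg : Q.Equivalent (-Q)) {m : ℕ} (hV : Module.finrank ℝ V = 2 * m) :
    sigPos Q = m ∧ sigNeg Q = m := by
  have hsum := QuadraticForm.sigPos_add_sigNeg_add_radical (Q := Q)
  rw [hQ, finrank_bot, hV] at hsum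
  have heq := hneg.sigPos_eq
  rw [sigPos_neg] at heq
  omega

end Signature

section ConstantMetric

variable [FiniteDimensional ℝ E]

namespace SemiRiemannianMetric

/-- The translation invariant metric given by a scalar product on `E`. -/
def const (b : LinearMap.BilinForm ℝ E) (hb_symm : b.IsSymm) (hb : b.Nondegenerate) :
    SemiRiemannianMetric E where
  form _ := b.toContinuousBilinearMap
  smooth := contDiff_const
  symm _ := hb_symm.eq
  nondegenerate _ := hb.1

variable {b : LinearMap.BilinForm ℝ E} {hb_symm : b.IsSymm} {hb : b.Nondegenerate}

theorem hasSignature_const {m : ℕ} (hE : Module.finrank ℝ E = 2 * m)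
    (hneg : (LinearMap.BilinMap.toQuadraticMap b).Equivalent
      (-LinearMap.BilinMap.toQuadraticMap b)) :
    (const b hb_symm hb).HasSignature m m :=
  fun _ => sigPos_eq_and_sigNeg_eq_of_equivalent_neg
    (radical_toQuadraticMap_eq_bot hb_symm hb) hneg hE

theorem isParallel_const_ofForm {A : E → E →L[ℝ] E →L[ℝ] E}
    (hA : ∀ x u, ((A x).flip u).toLinearMap ∈ b.skewAdjointSubmodule) :
    (const b hb_symm hb).IsParallel (LinearConnection.ofForm A) := by
  intro Y Z hY hZ x u
  have hderiv := (LinearMap.toContinuousBilinearMap b).hasFDerivAt_of_bilinear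
    (hY.differentiable (by simp) x).hasFDerivAt (hZ.differentiable (by simp) x).hasFDerivAt
  have hskew : b (A x (Y x) u) (Z x) = b (Y x) (-A x (Z x) u) :=
    (LinearMap.mem_skewAdjointSubmodule _).1 (hA x u) (Y x) (Z x)
  change fderiv ℝ (fun y => b.toContinuousBilinearMap (Y y) (Z y)) x u = _
  rw [hderiv.fderiv]
  change b (Y x) (fderiv ℝ Z x u) + b (fderiv ℝ Y x u) (Z x) =
    b (fderiv ℝ Y x u + A x (Y x) u) (Z x) + b (Y x) (fderiv ℝ Z x u + A x (Z x) u)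
  simp only [map_add, LinearMap.add_apply, hskew, map_neg]
  ring

theorem independent_const {ι : Type*} {B : ι → LinearMap.BilinForm ℝ E}
    {hB_symm : ∀ i, (B i).IsSymm} {hB : ∀ i, (B i).Nondegenerate} (h : LinearIndependent ℝ B) :
    Independent fun i => const (B i) (hB_symm i) (hB i) :=
  fun _ => .of_comp ContinuousLinearMap.toLinearMap₁₂ h

end SemiRiemannianMetric

end ConstantMetric

theorem IsIrreducibleNeutralFamily.exists_parallel_metrics {V ι : Type*} [AddCommGroup V]
    [Module ℝ V] {B : ι → LinearMap.BilinForm ℝ V} (hB : IsIrreducibleNeutralFamily B)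
    {m : ℕ} (hm : 0 < m) (hE : Module.finrank ℝ E = 2 * m)
    (hVE : Module.finrank ℝ V = Module.finrank ℝ E) :
    ∃ (g : ι → SemiRiemannianMetric E) (cov : LinearConnection E),
      SemiRiemannianMetric.Independent g ∧ (∀ i, (g i).HasSignature m m) ∧ cov.IsSmooth ∧
        (∀ i, (g i).IsParallel cov) ∧ cov.HasIrreducibleHolonomy := by
  have : FiniteDimensional ℝ E := Module.finite_of_finrank_pos (by omega)
  have : FiniteDimensional ℝ V := Module.finite_of_finrank_pos (by omega)
  have hBE := hB.congr (LinearEquiv.ofFinrankEq V E hVE)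
  obtain ⟨A, hA_smooth, hA_mem, hA_inv⟩ := exists_connectionForm_mem_invtSubmodule (by omega)
    (⨅ i, (LinearMap.BilinForm.congr (LinearEquiv.ofFinrankEq V E hVE) (B i)).skewAdjointSubmodule)
  exact ⟨fun i => .const _ (hBE.isSymm i) (hBE.nondegenerate i), .ofForm A,
    SemiRiemannianMetric.independent_const hBE.linearIndependent,
    fun i => SemiRiemannianMetric.hasSignature_const hE (hBE.equivalent_neg i),
    LinearConnection.isSmooth_ofForm hA_smooth,
    fun i => SemiRiemannianMetric.isParallel_const_ofForm fun x u =>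
      (Submodule.mem_iInf _).1 (hA_mem x u) i,
    fun x W hW => hBE.irreducible W (hA_inv x W hW)⟩

end Holonomy

end

theorem theorem2_general {E : Type*} [NormedAddCommGroup E] [NormedSpace ℝ E] :
    (∀ m : ℕ, Module.finrank ℝ E = 2 * m → 3 ≤ m →
      ∃ (g : Fin 2 → Holonomy.SemiRiemannianMetric E) (cov : Holonomy.LinearConnection E),
        Holonomy.SemiRiemannianMetric.Independent g ∧
        (∀ i, (g i).HasSignature m m) ∧
        cov.IsSmooth ∧
        (∀ i, (g i).IsParallel cov) ∧
        cov.HasIrreducibleHolonomy) ∧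
    (∀ m r : ℕ, Module.finrank ℝ E = 2 * m → m = 2 * r → 2 ≤ r →
      ∃ (g : Fin 3 → Holonomy.SemiRiemannianMetric E) (cov : Holonomy.LinearConnection E),
        Holonomy.SemiRiemannianMetric.Independent g ∧
        (∀ i, (g i).HasSignature m m) ∧
        cov.IsSmooth ∧
        (∀ i, (g i).IsParallel cov) ∧
        cov.HasIrreducibleHolonomy) := by
  refine ⟨fun m hE hm => ?_, fun m r hE hmr hr => ?_⟩
  · refine (Holonomy.isIrreducibleNeutralFamily_complex (ι := Fin m)
      (by simpa using hm)).exists_parallel_metrics (by omega) hE ?_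
    simp [Module.finrank_pi_fintype, Complex.finrank_real_complex, hE, mul_comm]
  · have : Nontrivial (Fin r) := Fin.nontrivial_iff_two_le.2 hr
    refine (Holonomy.isIrreducibleNeutralFamily_quaternion
      (ι := Fin r)).exists_parallel_metrics (by omega) hE ?_
    simp only [Module.finrank_pi_fintype, Quaternion.finrank_eq_four, Finset.sum_const,
      Finset.card_univ, Fintype.card_fin, smul_eq_mul]
    omega

theorem theorem2 :
    (∀ n m : ℕ, n = 2 * m → 3 ≤ m →
      ∃ (g : Fin 2 → Holonomy.SemiRiemannianMetric (EuclideanSpace ℝ (Fin n)))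
        (cov : Holonomy.LinearConnection (EuclideanSpace ℝ (Fin n))),
        Holonomy.SemiRiemannianMetric.Independent g ∧
        (∀ i, (g i).HasSignature m m) ∧
        cov.IsSmooth ∧
        (∀ i, (g i).IsParallel cov) ∧
        cov.HasIrreducibleHolonomy) ∧
    (∀ n m r : ℕ, n = 2 * m → m = 2 * r → 2 ≤ r →
      ∃ (g : Fin 3 → Holonomy.SemiRiemannianMetric (EuclideanSpace ℝ (Fin n)))
        (cov : Holonomy.LinearConnection (EuclideanSpace ℝ (Fin n))),
        Holonomy.SemiRiemannianMetric.Independent g ∧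
        (∀ i, (g i).HasSignature m m) ∧
        cov.IsSmooth ∧
        (∀ i, (g i).IsParallel cov) ∧
        cov.HasIrreducibleHolonomy) := by
  exact ⟨fun _ m hn => theorem2_general.1 m (by simp [hn]),
    fun _ m r hn => theorem2_general.2 m r (by simp [hn])⟩
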